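/- Let $N,M\ge 0$ be integers and let $[n]=\frac{q^n-q^{-n}}{q-q^{-1}}$, $\begin{bmatrix} n\\k\end{bmatrix}=\prod_{i=0}^{k-1}[n-i]\big/\prod_{i=1}^{k}[i]$. **MOY graphs.** A MOY graph is a finite oriented planar trivalent graph $\Gamma$ (circles without vertices are allowed) whose edges $e$ carry labels $\ell(e)\in\mathbb Z_{\ge 0}$ such that each vertex, drawn with its edges running upwards, is either a merge (thin edges labeled $a$, $b$ at the bottom left and right, thick edge labeled $a+b$ at the top) or a split (thick edge labeled $a+b$ at the bottom, thin edges labeled $a$, $b$ at the top left and right). Its rotational $\rho(\Gamma)$ is the number of counterclockwise circles minus the number of clockwise circles of the simple multi-curve obtained by replacing each edge $e$ by $\ell(e)$ parallel copies, joined without crossings at the vertices. A sub-MOY graph of $\Gamma$ is a MOY graph on the same underlying oriented plane graph with labels $\ell'\le\ell$; it is cyclic if $\ell'\le 1$. For sub-MOY graphs $\Gamma_1,\Gamma_2$ of $\Gamma$ put $u(\Gamma_1,\Gamma_2)=\sum_s (a_2b_1-a_1b_2)$, the sum over the split vertices $s$ of $\Gamma$, where $a_i$ and $b_i$ are the labels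 in $\Gamma_i$ of the left and the right thin edge at $s$; and $b(\Gamma_1)=\prod_s \begin{bmatrix} a_1+b_1\\ b_1\end{bmatrix}$. An $(N|M)$-coloring $c$ of $\Gamma$ consists of cyclic sub-MOY graphs $E_1,\dots,E_N$ and sub-MOY graphs $S_1,\dots,S_M$ of $\Gamma$ whose labels add up to those of $\Gamma$. Put $$w_s(c)=\sum_{1\le i<j\le M}u(S_j,S_i)-\sum_{1\le i<j\le N}u(E_j,E_i)+\sum_{i=1}^N\sum_{j=1}^M u(E_i,S_j),$$ $$w_\rho(c)=\sum_{i=1}^N (N+M-2i+1)\rho(E_i)+\sum_{j=1}^M (N+M-2j+1)\rho(S_j),$$ $$\langle\Gamma\rangle=\sum_{c}(-1)^{\sum_{j}\rho(S_j)}\,q^{w_s(c)+w_\rho(c)}\prod_{j=1}^M b(S_j)\in\mathbb Z[q,q^{-1}],$$ the sum over all $(N|M)$-colorings $c$ of $\Gamma$. **Link diagrams.** Let $D$ be an oriented link diagram whose components are labeled by non-negative integers. Its evaluation $\langle D\rangle$ is obtained by replacing, at each crossing, drawn with both strands running upwards, where the strand from the bottom left has label $n$ and the one from the bottom right has label $m$,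 the diagram by $$\sum_{k=\max(0,m-n)}^{m}(-1)^{m-k}q^{\pm(k-m)}\,\langle\Gamma_k\rangle ,$$ with sign $+$ for a positive and $-$ for a negative crossing. Here $\Gamma_k$ is the MOY graph in which the bottom right edge $m$ splits into $k$ (left) and $m-k$ (right), the edge $k$ merges with the bottom left edge $n$ into an edge $n+k$, which splits into the top left edge $m$ and an edge $n+k-m$, and the latter merges with $m-k$ into the top right edge $n$. Put $$P_{N|M}(D)=(-1)^{e(D)}q^{k(D)}\langle D\rangle,$$ where each crossing between two strands of the same label $m$ contributes $m$ to $e(D)$ and $\pm m(N-M-m+1)$ to $k(D)$, according to its sign, and crossings between strands of different labels contribute nothing. **Proposition (skein relation).** Let $L_+$, $L_-$ and $L_0$ be labeled oriented link diagrams which coincide outside a disk in which $L_+$ (resp. $L_-$) is a single positive (resp. negative) crossing between two strands labeled $1$, and $L_0$ is the oriented smoothing of this crossing. Then $$q^{M-N}P_{N|M}(L_+)-q^{N-M}P_{N|M}(L_-)=(q^{-1}-q)\,P_{N|M}(L_0).$$ -/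

import Mathlib

open scoped BigOperators

namespace MOY

noncomputable section

/-! ### Quantum integers and quantum binomials

All values live in the ring of Laurent polynomials in `q` with integral coefficients, where
`q ^ n` is `LaurentPolynomial.T n`. -/

/-- The Laurent monomial `q ^ n`. -/
abbrev qpow (n : ℤ) : LaurentPolynomial ℤ := LaurentPolynomial.T n

/-- The quantum integer `[n] = (q ^ n - q ^ (-n)) / (q - q⁻¹)`. -/
def qint (n : ℤ) : LaurentPolynomial ℤ :=
  LaurentPolynomial.C n.sign * ∑ i ∈ Finset.range n.natAbs, qpow (2 * (i : ℤ) + 1 - (n.natAbs : ℤ))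

/-- The quantum binomial for natural numbers (the only ones needed here), by the Pascal rule; the
quotient formula is `qbinom_mul_prod`. -/
def qbinom : ℕ → ℕ → LaurentPolynomial ℤ
  | _, 0 => 1
  | 0, _ + 1 => 0
  | n + 1, k + 1 => qpow ((k : ℤ) + 1) * qbinom n (k + 1) + qpow ((k : ℤ) - n) * qbinom n k

theorem qint_spec (n : ℤ) : (qpow 1 - qpow (-1)) * qint n = qpow n - qpow (-n) := by
  have key : ∀ m : ℕ, (qpow 1 - qpow (-1)) *
      ∑ i ∈ Finset.range m, qpow (2 * (i : ℤ) + 1 - (m : ℤ)) = qpow m - qpow (-m) := by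
    intro m
    have tel : ∀ (c : ℤ) (k : ℕ), (qpow 1 - qpow (-1)) *
        ∑ i ∈ Finset.range k, qpow (2 * (i : ℤ) + 1 - c) = qpow (2 * (k : ℤ) - c) - qpow (-c) := by
      intro c k
      induction k with
      | zero => simp
      | succ k ih =>
        rw [Finset.sum_range_succ, mul_add, ih, sub_mul, ← LaurentPolynomial.T_add,
          ← LaurentPolynomial.T_add]
        have h1 : (1 : ℤ) + (2 * (k : ℤ) + 1 - c) = 2 * ((k + 1 : ℕ) : ℤ) - c := by push_cast; ring
        have h2 : (-1 : ℤ) + (2 * (k : ℤ) + 1 - c) = 2 * (k : ℤ) - c := by ring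
        rw [h1, h2]; ring
    rw [tel]
    congr 2
    ring
  unfold qint
  rcases lt_trichotomy n 0 with h | h | h
  · have hn : ((n.natAbs : ℕ) : ℤ) = -n := by omega
    rw [Int.sign_eq_neg_one_of_neg h]
    have := key n.natAbs
    rw [hn] at this ⊢
    simp only [map_neg, map_one, neg_mul, one_mul, mul_neg]
    rw [this]; simp
  · subst h; simp
  · have hn : ((n.natAbs : ℕ) : ℤ) = n := by omega
    rw [Int.sign_eq_one_of_pos h]
    have := key n.natAbs
    rw [hn] at this ⊢
    simpa using this

/-- The defining formula of the quantum binomial. -/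
theorem qbinom_mul_prod (n k : ℕ) :
    qbinom n k * ∏ i ∈ Finset.range k, qint ((i : ℤ) + 1) =
      ∏ i ∈ Finset.range k, qint ((n : ℤ) - i) := by
  have hne : (qpow 1 - qpow (-1)) ≠ 0 := by
    intro h
    have := congrArg (fun p : LaurentPolynomial ℤ => p.coeff 1) h
    simp [qpow] at this
  have hadd : ∀ a b : ℤ, qint (a + b) = qpow b * qint a + qpow (-a) * qint b := by
    intro a b
    apply mul_left_cancel₀ hne
    rw [mul_add, mul_left_comm _ (qpow b), mul_left_comm _ (qpow (-a)), qint_spec, qint_spec,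
      qint_spec, mul_sub, mul_sub, ← LaurentPolynomial.T_add, ← LaurentPolynomial.T_add,
      ← LaurentPolynomial.T_add, ← LaurentPolynomial.T_add, add_comm b a, add_comm b (-a), neg_add]
    ring
  have shift : ∀ (n k : ℕ), ∏ i ∈ Finset.range (k + 1), qint (((n + 1 : ℕ) : ℤ) - i) =
      (∏ i ∈ Finset.range k, qint ((n : ℤ) - i)) * qint ((n : ℤ) + 1) := by
    intro n k
    rw [Finset.prod_range_succ']
    have h0 : ((n + 1 : ℕ) : ℤ) - ((0 : ℕ) : ℤ) = (n : ℤ) + 1 := by simp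
    rw [h0]
    congr 1
    refine Finset.prod_congr rfl fun i _ => ?_
    congr 1; push_cast; ring
  induction n generalizing k with
  | zero =>
    cases k with
    | zero => simp [qbinom]
    | succ k =>
      rw [Finset.prod_range_succ' (fun i => qint (((0 : ℕ) : ℤ) - i))]
      simp [qbinom, qint]
  | succ n ih =>
    cases k with
    | zero => simp [qbinom]
    | succ k =>
      rw [shift, qbinom, add_mul, mul_assoc, ih (k + 1), Finset.prod_range_succ,
        Finset.prod_range_succ]
      have e : qint ((n : ℤ) + 1) = qpow ((k : ℤ) + 1) * qint ((n : ℤ) - k) +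
          qpow ((k : ℤ) - n) * qint ((k : ℤ) + 1) := by
        rw [← neg_sub (n : ℤ) k, ← hadd]
        congr 1; ring
      rw [e, ← ih k]
      ring

/-! ### Plane diagrams cut into horizontal slices

A diagram in the plane is put in general position with respect to the height function and cut
into horizontal slices, each of which holds one elementary piece, with vertical strands on its left
and on its right. It is recorded as the list of its slices, from bottom to top. Every planar isotopy
class of diagrams has such a presentation, in which the strands at each crossing (or vertex) run
upwards. Labels are recorded on all strands. -/

/-- The direction in which an oriented strand crosses a horizontal line. -/
inductive Dir
  | up
  | down

/-- The opposite direction. -/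
def Dir.rev : Dir → Dir
  | .up => .down
  | .down => .up

/-- An oriented strand with a label. -/
structure Strand where
  dir : Dir
  label : ℕ

/-- The strand with label `a` that runs upwards. -/
abbrev upStrand (a : ℕ) : Strand := ⟨.up, a⟩

/-- A type of elementary pieces, with the strands (from left to right) at the bottom and at the top
of each piece. -/
class Elementary (P : Type) where
  src : P → List Strand
  tgt : P → List Strand

/-- One slice: vertical strands `left`, then an elementary piece, then vertical strands `right`. -/
structure Slice (P : Type) where
  left : List Strand
  piece : P
  right : List Strand

section Words

variable {P : Type} [Elementary P]

/-- The strands at the bottom of a slice. -/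
def Slice.bot (s : Slice P) : List Strand := s.left ++ Elementary.src s.piece ++ s.right

/-- The strands at the top of a slice. -/
def Slice.top (s : Slice P) : List Strand := s.left ++ Elementary.tgt s.piece ++ s.right

/-- The slices `w` fit on top of each other and lead from the strands `x` at the bottom to the
strands `y` at the top. In particular orientations and labels are constant along vertical strands. -/
def IsPath : List Strand → List (Slice P) → List Strand → Prop
  | x, [], y => x = y
  | x, s :: w, y => s.bot = x ∧ IsPath s.top w y

/-- The slices `w` fit together to a closed diagram (no end points). -/
def IsClosedWord (w : List (Slice P)) : Prop := IsPath [] w []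

end Words

/-! ### MOY graphs -/

/-- The elementary pieces of MOY graphs. For `cup` and `cap`, `d` is the direction of the left leg
and `a` is the label; `merge a b` and `split a b` are the trivalent vertices with left thin edge
labeled `a`, right thin edge labeled `b` and thick edge labeled `a + b`. -/
inductive MOYPiece
  | cup (d : Dir) (a : ℕ)
  | cap (d : Dir) (a : ℕ)
  | merge (a b : ℕ)
  | split (a b : ℕ)

instance : Elementary MOYPiece where
  src
    | .cup _ _ => []
    | .cap d a => [⟨d, a⟩, ⟨d.rev, a⟩]
    | .merge a b => [upStrand a, upStrand b]
    | .split a b => [upStrand (a + b)]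
  tgt
    | .cup d a => [⟨d, a⟩, ⟨d.rev, a⟩]
    | .cap _ _ => []
    | .merge a b => [upStrand (a + b)]
    | .split a b => [upStrand a, upStrand b]

/-- A list of slices without crossings. It is a MOY graph when it is closed (`IsClosedWord`). -/
abbrev MOYWord := List (Slice MOYPiece)

/-! ### Cabling and rotational -/

/-- The elementary pieces of an (unlabeled) oriented simple multi-curve: minima and maxima, with the
direction `d` of the left leg. -/
inductive Turn
  | cup (d : Dir)
  | cap (d : Dir)

/-- A slice of an oriented simple multi-curve: one minimum or maximum, with `left` vertical strands
on its left and `right` vertical strands on its right. -/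
structure CurveSlice where
  left : ℕ
  turn : Turn
  right : ℕ

/-- The number of parallel intervals that replace a list of labeled strands. -/
def width (l : List Strand) : ℕ := (l.map Strand.label).sum

/-- The cabling of one slice. A cup (cap) with label `a` becomes `a` nested cups (caps), the
outermost cup being the lowest one and the outermost cap the highest one; the parallel intervals
run straight through a vertex. -/
def cableSlice : Slice MOYPiece → List CurveSlice
  | ⟨l, .cup d a, r⟩ =>
      (List.range a).map fun j => ⟨width l + j, .cup d, j + width r⟩
  | ⟨l, .cap d a, r⟩ =>
      (List.range a).reverse.map fun j => ⟨width l + j, .cap d, j + width r⟩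
  | ⟨_, .merge _ _, _⟩ => []
  | ⟨_, .split _ _, _⟩ => []

/-- The cabling: each edge is replaced by as many parallel copies as its label says. -/
def cabling (w : MOYWord) : List CurveSlice := w.flatMap cableSlice

/-- The point `(t, i)` is the `i`-th intersection point (from the left, counted from `0`) of the
multi-curve with the horizontal line below the slice number `t`. Two points are joined if the
multi-curve contains an arc between them inside one slice. -/
inductive Joined (γ : List CurveSlice) : ℕ × ℕ → ℕ × ℕ → Prop
  | cup_turn {t p r : ℕ} {d : Dir} (h : γ[t]? = some ⟨p, .cup d, r⟩) :
      Joined γ (t + 1, p) (t + 1, p + 1)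
  | cup_left {t p r i : ℕ} {d : Dir} (h : γ[t]? = some ⟨p, .cup d, r⟩) (hi : i < p) :
      Joined γ (t, i) (t + 1, i)
  | cup_right {t p r i : ℕ} {d : Dir} (h : γ[t]? = some ⟨p, .cup d, r⟩) (hi : i < r) :
      Joined γ (t, p + i) (t + 1, p + 2 + i)
  | cap_turn {t p r : ℕ} {d : Dir} (h : γ[t]? = some ⟨p, .cap d, r⟩) :
      Joined γ (t, p) (t, p + 1)
  | cap_left {t p r i : ℕ} {d : Dir} (h : γ[t]? = some ⟨p, .cap d, r⟩) (hi : i < p) :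
      Joined γ (t, i) (t + 1, i)
  | cap_right {t p r i : ℕ} {d : Dir} (h : γ[t]? = some ⟨p, .cap d, r⟩) (hi : i < r) :
      Joined γ (t, p + 2 + i) (t + 1, p + i)

/-- Classes of points under the equivalence relation generated by `Joined`. The circles of the
multi-curve are the classes that contain a leg of a cup. -/
abbrev Component (γ : List CurveSlice) := Quot (Joined γ)

/-- The slice number `t` is a cup whose left leg has direction `d`, and it is the lowest point of
the circle `C`. -/
def IsLowestCup (γ : List CurveSlice) (C : Component γ) (t : ℕ) (d : Dir) : Prop :=
  (∃ p r, γ[t]? = some ⟨p, .cup d, r⟩ ∧ Quot.mk (Joined γ) (t + 1, p) = C) ∧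
    ∀ t' p' r' d', γ[t']? = some ⟨p', .cup d', r'⟩ →
      Quot.mk (Joined γ) (t' + 1, p') = C → t ≤ t'

/-- A circle in the plane is oriented counterclockwise iff it runs from left to right at its lowest
point, i.e. comes down the left leg of its lowest cup. -/
def IsCCW (γ : List CurveSlice) (C : Component γ) : Prop := ∃ t, IsLowestCup γ C t .down

/-- A circle in the plane is oriented clockwise iff it runs from right to left at its lowest
point. -/
def IsCW (γ : List CurveSlice) (C : Component γ) : Prop := ∃ t, IsLowestCup γ C t .up

/-- The rotational of a simple multi-curve: the number of counterclockwise circles minus the number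
of clockwise circles. -/
def curveRotational (γ : List CurveSlice) : ℤ :=
  ({C | IsCCW γ C}.ncard : ℤ) - ({C | IsCW γ C}.ncard : ℤ)

/-- The rotational of a MOY graph. -/
def rotational (w : MOYWord) : ℤ := curveRotational (cabling w)

/-! ### Sub-MOY graphs and colorings -/

/-- The label of the `i`-th strand on the horizontal line below the slice number `t` (and `0` if
there is no such strand). -/
def label (w : MOYWord) (t i : ℕ) : ℕ :=
  ((w.map fun s => s.bot.map Strand.label).getD t []).getD i 0

/-- Same orientation, and at most the same label. -/
def Strand.Le (x y : Strand) : Prop := x.dir = y.dir ∧ x.label ≤ y.label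

/-- Same underlying oriented piece, with at most the same labels. -/
def MOYPiece.Le : MOYPiece → MOYPiece → Prop
  | .cup d a, .cup d' a' => d = d' ∧ a ≤ a'
  | .cap d a, .cap d' a' => d = d' ∧ a ≤ a'
  | .merge a b, .merge a' b' => a ≤ a' ∧ b ≤ b'
  | .split a b, .split a' b' => a ≤ a' ∧ b ≤ b'
  | _, _ => False

/-- Same underlying oriented slice, with at most the same labels. -/
def SliceLe (s t : Slice MOYPiece) : Prop :=
  List.Forall₂ Strand.Le s.left t.left ∧ s.piece.Le t.piece ∧
    List.Forall₂ Strand.Le s.right t.right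

/-- `v` is a sub-MOY graph of `w`: a MOY graph with the same underlying oriented plane graph, whose
labels are at most those of `w`. -/
def IsSubMOY (v w : MOYWord) : Prop := IsClosedWord v ∧ List.Forall₂ SliceLe v w

/-- All labels are at most `1`. -/
def IsCyclic (v : MOYWord) : Prop := ∀ t i, label v t i ≤ 1

/-- An `(N|M)`-coloring of `w`: `N` cyclic sub-MOY graphs and `M` sub-MOY graphs, with sum `w`. -/
structure IsColoring (N M : ℕ) (w : MOYWord)
    (c : (Fin N → MOYWord) × (Fin M → MOYWord)) : Prop where
  subE : ∀ i, IsSubMOY (c.1 i) w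
  cyclicE : ∀ i, IsCyclic (c.1 i)
  subS : ∀ j, IsSubMOY (c.2 j) w
  sum_eq : ∀ t i, ∑ j, label (c.1 j) t i + ∑ j, label (c.2 j) t i = label w t i

theorem finite_forall₂ {α β : Type} (R : α → β → Prop) (hR : ∀ b, {a | R a b}.Finite)
    (l : List β) : {k | List.Forall₂ R k l}.Finite := by
  induction l with
  | nil => simp
  | cons b l ih =>
    refine (Set.Finite.image2 List.cons (hR b) ih).subset ?_
    rintro k hk
    cases hk with
    | cons h1 h2 => exact ⟨_, h1, _, h2, rfl⟩

theorem finite_strandLe (y : Strand) : {x | Strand.Le x y}.Finite := by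
  refine ((Set.finite_Iic y.label).image (fun a => (⟨y.dir, a⟩ : Strand))).subset ?_
  rintro ⟨d, a⟩ ⟨h1, h2⟩
  simp only at h1
  exact ⟨a, h2, by simp [h1]⟩

theorem finite_pieceLe (y : MOYPiece) : {x | MOYPiece.Le x y}.Finite := by
  cases y with
  | cup d a =>
    refine ((Set.finite_Iic a).image (fun a => MOYPiece.cup d a)).subset ?_
    rintro (⟨d', a'⟩ | _ | _ | _) h <;> simp_all [MOYPiece.Le]
  | cap d a =>
    refine ((Set.finite_Iic a).image (fun a => MOYPiece.cap d a)).subset ?_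
    rintro (_ | ⟨d', a'⟩ | _ | _) h <;> simp_all [MOYPiece.Le]
  | merge a b =>
    refine (Set.Finite.image2 MOYPiece.merge (Set.finite_Iic a) (Set.finite_Iic b)).subset ?_
    rintro (_ | _ | ⟨a', b'⟩ | _) h <;> simp_all [MOYPiece.Le]
  | split a b =>
    refine (Set.Finite.image2 MOYPiece.split (Set.finite_Iic a) (Set.finite_Iic b)).subset ?_
    rintro (_ | _ | _ | ⟨a', b'⟩) h <;> simp_all [MOYPiece.Le]

theorem finite_sliceLe (t : Slice MOYPiece) : {s | SliceLe s t}.Finite := by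
  refine (Set.Finite.image (fun x : List Strand × MOYPiece × List Strand =>
    (⟨x.1, x.2.1, x.2.2⟩ : Slice MOYPiece)) ((finite_forall₂ _ finite_strandLe t.left).prod
      ((finite_pieceLe t.piece).prod (finite_forall₂ _ finite_strandLe t.right)))).subset ?_
  rintro ⟨l, p, r⟩ ⟨h1, h2, h3⟩
  exact ⟨(l, p, r), ⟨h1, h2, h3⟩, rfl⟩

theorem finite_colorings (N M : ℕ) (w : MOYWord) : {c | IsColoring N M w c}.Finite := by
  have h : {v | IsSubMOY v w}.Finite :=
    (finite_forall₂ _ finite_sliceLe w).subset fun v hv => hv.2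
  refine ((Set.Finite.pi' fun _ : Fin N => h).prod (Set.Finite.pi' fun _ : Fin M => h)).subset ?_
  intro c hc
  exact ⟨fun i => hc.subE i, fun j => hc.subS j⟩

/-- The finite set of `(N|M)`-colorings of `w`. -/
def colorings (N M : ℕ) (w : MOYWord) : Finset ((Fin N → MOYWord) × (Fin M → MOYWord)) :=
  (finite_colorings N M w).toFinset

/-! ### The evaluation of MOY graphs -/

/-- The binomial weight of a MOY graph. -/
def binomialWeight (w : MOYWord) : LaurentPolynomial ℤ :=
  (w.map fun s =>
    match s.piece with
    | .split a b => qbinom (a + b) b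
    | _ => 1).prod

/-- The contribution of one slice to `u`: `a₂ b₁ - a₁ b₂` at a split vertex. -/
def uSlice (s₁ s₂ : Slice MOYPiece) : ℤ :=
  match s₁.piece, s₂.piece with
  | .split a₁ b₁, .split a₂ b₂ => (a₂ : ℤ) * b₁ - (a₁ : ℤ) * b₂
  | _, _ => 0

/-- The integer `u(Γ₁, Γ₂)` for two sub-MOY graphs of the same graph. -/
def u (w₁ w₂ : MOYWord) : ℤ := (List.zipWith uSlice w₁ w₂).sum

section Evaluation

variable (N M : ℕ) (c : (Fin N → MOYWord) × (Fin M → MOYWord))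

/-- The `s`-weight of a coloring. -/
def sWeight : ℤ :=
  (∑ j, ∑ i ∈ Finset.univ.filter (fun i : Fin M => i < j), u (c.2 j) (c.2 i))
    - (∑ j, ∑ i ∈ Finset.univ.filter (fun i : Fin N => i < j), u (c.1 j) (c.1 i))
    + ∑ i, ∑ j, u (c.1 i) (c.2 j)

/-- The `ρ`-weight of a coloring. The element `i` of `Fin N` stands for the index `i + 1`. -/
def rhoWeight : ℤ :=
  (∑ i : Fin N, ((N : ℤ) + M - 2 * ((i : ℤ) + 1) + 1) * rotational (c.1 i))
    + ∑ j : Fin M, ((N : ℤ) + M - 2 * ((j : ℤ) + 1) + 1) * rotational (c.2 j)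

/-- The multiplicity of a coloring. -/
def multiplicity : LaurentPolynomial ℤ := ∏ j, binomialWeight (c.2 j)

/-- The parity of a coloring. -/
def parity : ℤ := ∑ j, rotational (c.2 j)

/-- The combinatorial `(N|M)`-evaluation of a coloring. -/
def evalColoring : LaurentPolynomial ℤ :=
  (-1) ^ (parity N M c).natAbs * qpow (sWeight N M c + rhoWeight N M c) * multiplicity N M c

/-- The combinatorial `(N|M)`-evaluation of a MOY graph. -/
def evalMOY (w : MOYWord) : LaurentPolynomial ℤ := ∑ c ∈ colorings N M w, evalColoring N M c

end Evaluation

/-! ### Labeled link diagrams -/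

/-- The sign of a crossing. -/
inductive CrossingSign
  | pos
  | neg

/-- `1` for a positive crossing, `-1` for a negative one. -/
def CrossingSign.toInt : CrossingSign → ℤ
  | .pos => 1
  | .neg => -1

/-- The elementary pieces of labeled link diagrams. In `crossing s n m` both strands run upwards,
one with label `n` from the bottom left to the top right, and one with label `m` from the bottom
right to the top left; the first one is the upper strand iff the crossing is positive. -/
inductive LinkPiece
  | cup (d : Dir) (a : ℕ)
  | cap (d : Dir) (a : ℕ)
  | crossing (s : CrossingSign) (n m : ℕ)

instance : Elementary LinkPiece where
  src
    | .cup _ _ => []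
    | .cap d a => [⟨d, a⟩, ⟨d.rev, a⟩]
    | .crossing _ n m => [upStrand n, upStrand m]
  tgt
    | .cup d a => [⟨d, a⟩, ⟨d.rev, a⟩]
    | .cap _ _ => []
    | .crossing _ n m => [upStrand m, upStrand n]

/-- A labeled oriented link diagram. -/
structure LinkDiagram where
  slices : List (Slice LinkPiece)
  closed : IsClosedWord slices

/-- The MOY graph that replaces a crossing in the term with index `k`: the right strand `m` splits
into `k` and `m - k`, the edge `k` merges with the left strand `n`, the result splits into `m` and
`n + k - m`, and the latter merges with `m - k` into `n`. -/
def square (l : List Strand) (n m k : ℕ) (r : List Strand) : MOYWord :=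
  [⟨l ++ [upStrand n], .split k (m - k), r⟩,
    ⟨l, .merge n k, upStrand (m - k) :: r⟩,
    ⟨l, .split m (n + k - m), upStrand (m - k) :: r⟩,
    ⟨l ++ [upStrand m], .merge (n + k - m) (m - k), r⟩]

/-- In the range of the sum over `k`, the replacement has the same end points as the crossing. -/
theorem isPath_square (l : List Strand) (n m k : ℕ) (r : List Strand)
    (hk : k ∈ Finset.Icc (m - n) m) :
    IsPath (l ++ [upStrand n, upStrand m] ++ r) (square l n m k r)
      (l ++ [upStrand m, upStrand n] ++ r) := by
  rw [Finset.mem_Icc] at hk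
  have h1 : k + (m - k) = m := by omega
  have h2 : m + (n + k - m) = n + k := by omega
  have h3 : n + k - m + (m - k) = n := by omega
  simp [square, IsPath, Slice.bot, Slice.top, Elementary.src, Elementary.tgt, h1, h2, h3]

/-- The `(N|M)`-evaluation of a diagram which consists of the slices `w`, without crossings, below
the slices `D`, with the crossings of `D` still to be replaced:
`⟨X₊⟩ = ∑ (-1) ^ (m - k) q ^ (k - m) ⟨Γ_k⟩` and `⟨X₋⟩ = ∑ (-1) ^ (m - k) q ^ (m - k) ⟨Γ_k⟩`, the sums
over `k` from `max 0 (m - n)` to `m`. -/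
def bracketAux (N M : ℕ) : MOYWord → List (Slice LinkPiece) → LaurentPolynomial ℤ
  | w, [] => evalMOY N M w
  | w, ⟨l, .cup d a, r⟩ :: D => bracketAux N M (w ++ [⟨l, .cup d a, r⟩]) D
  | w, ⟨l, .cap d a, r⟩ :: D => bracketAux N M (w ++ [⟨l, .cap d a, r⟩]) D
  | w, ⟨l, .crossing s n m, r⟩ :: D =>
      ∑ k ∈ Finset.Icc (m - n) m,
        (-1) ^ (m - k) * qpow (s.toInt * ((k : ℤ) - m)) *
          bracketAux N M (w ++ square l n m k r) D

/-- The `(N|M)`-evaluation of a labeled link diagram. -/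
def bracket (N M : ℕ) (D : LinkDiagram) : LaurentPolynomial ℤ := bracketAux N M [] D.slices

/-- The integer `k_x` if the slice holds a crossing `x`, and `0` otherwise. -/
def kSlice (N M : ℕ) (x : Slice LinkPiece) : ℤ :=
  match x.piece with
  | .crossing s n m => if n = m then s.toInt * ((m : ℤ) * ((N : ℤ) - M - m + 1)) else 0
  | _ => 0

/-- The integer `e_x` if the slice holds a crossing `x`, and `0` otherwise. -/
def eSlice (x : Slice LinkPiece) : ℕ :=
  match x.piece with
  | .crossing _ n m => if n = m then m else 0
  | _ => 0

/-- The link invariant `P_{N|M}(D) = (-1) ^ e(D) q ^ k(D) ⟨D⟩`. -/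
def P (N M : ℕ) (D : LinkDiagram) : LaurentPolynomial ℤ :=
  (-1) ^ (D.slices.map eSlice).sum * qpow (D.slices.map (kSlice N M)).sum * bracket N M D

/-- The three diagrams are the same except in a small disk, where the two strands have label `1` and
run upwards, and where `Dp` has a positive crossing, `Dn` has a negative crossing, and `D0` has
two parallel vertical strands. The labels outside of the disk are arbitrary. -/
def SkeinTriple (Dp Dn D0 : LinkDiagram) : Prop :=
  ∃ (A B : List (Slice LinkPiece)) (l r : List Strand),
    Dp.slices = A ++ [⟨l, .crossing .pos 1 1, r⟩] ++ B ∧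
    Dn.slices = A ++ [⟨l, .crossing .neg 1 1, r⟩] ++ B ∧
    D0.slices = A ++ B

end

end MOY

/-!
Resolving a crossing of two strands labeled `1` gives `⟨L₊⟩ = ⟨Γ₁⟩ - q⁻¹ ⟨Γ₀⟩` and
`⟨L₋⟩ = ⟨Γ₁⟩ - q ⟨Γ₀⟩`. The framing factors of the two crossings are `- q ^ (N - M)` and
`- q ^ (M - N)`, so that on the left-hand side of the skein relation the terms `⟨Γ₁⟩` cancel and
`(q⁻¹ - q) ⟨Γ₀⟩` remains.

In `Γ₀` the two rungs of the square are labeled `0`, and it remains to see that they may be erased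
(`IsErasure.evalMOY_eq`). Every sub-MOY graph has label `0` on these rungs as well, so deleting the
four slices of the square is a bijection between the colorings of the graphs with and without the
rungs (`IsErasure.exists_right`, `IsErasure.exists_left`). It preserves all weights:
vertices are invisible to the cabling, and a split with a zero label contributes `0` to `u` and `1`
to the binomial weight. This extends to the other crossings of the diagram, since the bracket is
built from evaluations of MOY graphs (`bracketAux_trivialSquare`, `bracketAux_skein`).
-/

namespace MOY

/-! ### Composable words -/

theorem isPath_append {P : Type} [Elementary P] {x y : List Strand} {v w : List (Slice P)} :
    IsPath x (v ++ w) y ↔ ∃ z, IsPath x v z ∧ IsPath z w y := by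
  induction v generalizing x with
  | nil => simp [IsPath]
  | cons s v ih => simp [IsPath, ih, and_assoc]

theorem IsPath.right_unique {P : Type} [Elementary P] {x y z : List Strand} {w : List (Slice P)}
    (hy : IsPath x w y) (hz : IsPath x w z) : y = z := by
  induction w generalizing x with
  | nil => exact Eq.trans (Eq.symm hy) hz
  | cons s w ih => exact ih hy.2 hz.2

theorem MOYPiece.Le.tgt {p p' : MOYPiece} (h : p'.Le p) :
    List.Forall₂ Strand.Le (Elementary.tgt p') (Elementary.tgt p) := by
  cases p <;> cases p' <;> simp_all [MOYPiece.Le, Elementary.tgt, Strand.Le]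
  omega

theorem SliceLe.top {s s' : Slice MOYPiece} (h : SliceLe s' s) :
    List.Forall₂ Strand.Le s'.top s.top :=
  List.rel_append (List.rel_append h.1 h.2.1.tgt) h.2.2

theorem IsPath.forall₂_le {x x' y y' : List Strand} {w w' : MOYWord}
    (hx : List.Forall₂ Strand.Le x' x) (hw : List.Forall₂ SliceLe w' w)
    (h' : IsPath x' w' y') (h : IsPath x w y) : List.Forall₂ Strand.Le y' y := by
  induction hw generalizing x x' with
  | nil =>
    cases h
    cases h'
    exact hx
  | cons hs _ ih => exact ih hs.top h'.2 h.2

/-- If `w` fits on top of a non-empty row of strands and closes it up, then its lowest line is that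
row. -/
theorem IsPath.exists_cons {P : Type} [Elementary P] {x : List Strand} {w : List (Slice P)}
    (hx : x ≠ []) (h : IsPath x w []) : ∃ s w', w = s :: w' ∧ s.bot = x := by
  cases w with
  | nil => exact absurd h hx
  | cons s w' => exact ⟨s, w', rfl, h.1⟩

theorem exists_of_forall₂_append {α β : Type} {R : α → β → Prop} {v : List α} {w₁ w₂ : List β}
    (h : List.Forall₂ R v (w₁ ++ w₂)) :
    ∃ v₁ v₂, v = v₁ ++ v₂ ∧ List.Forall₂ R v₁ w₁ ∧ List.Forall₂ R v₂ w₂ :=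
  ⟨_, _, (List.take_append_drop w₁.length v).symm, List.forall₂_take_append _ _ _ h,
    List.forall₂_drop_append _ _ _ h⟩

theorem forall₂_le_middle {x l r : List Strand} {a b : ℕ}
    (h : List.Forall₂ Strand.Le x (l ++ [upStrand a, upStrand b] ++ r)) :
    ∃ l' a' b' r', x = l' ++ [upStrand a', upStrand b'] ++ r' ∧
      List.Forall₂ Strand.Le l' l ∧ a' ≤ a ∧ b' ≤ b ∧ List.Forall₂ Strand.Le r' r := by
  induction l generalizing x with
  | nil =>
    simp only [List.nil_append, List.cons_append, List.forall₂_cons_right_iff] at h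
    obtain ⟨⟨d, a'⟩, _, ⟨h1, h2⟩, ⟨⟨e, b'⟩, r', ⟨h3, h4⟩, h5, rfl⟩, rfl⟩ := h
    cases h1
    cases h3
    exact ⟨[], a', b', r', rfl, .nil, h2, h4, h5⟩
  | cons s l ih =>
    simp only [List.cons_append, List.forall₂_cons_right_iff] at h
    obtain ⟨s', x, h1, h2, rfl⟩ := h
    obtain ⟨l', a', b', r', rfl, h3, h4, h5, h6⟩ := ih h2
    exact ⟨_ :: l', a', b', r', rfl, .cons h1 h3, h4, h5, h6⟩

theorem middle_inj {l l' r r' : List Strand} {a b a' b' : ℕ} (hl : l.length = l'.length)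
    (h : l ++ [upStrand a, upStrand b] ++ r = l' ++ [upStrand a', upStrand b'] ++ r') :
    l = l' ∧ a = a' ∧ b = b' ∧ r = r' := by
  rw [List.append_assoc, List.append_assoc] at h
  obtain ⟨h1, h2⟩ := List.append_inj h hl
  simp_all

/-! ### The square with trivial rungs -/

/-- The square whose two rungs are labeled `0`, between strands labeled `a` and `b`. For
`a = b = 1` it is the term with index `0` in the resolution of a crossing. -/
def trivialSquare (l : List Strand) (a b : ℕ) (r : List Strand) : MOYWord :=
  [⟨l ++ [upStrand a], .split 0 b, r⟩,
    ⟨l, .merge a 0, upStrand b :: r⟩,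
    ⟨l, .split a 0, upStrand b :: r⟩,
    ⟨l ++ [upStrand a], .merge 0 b, r⟩]

theorem isPath_trivialSquare {l r x y : List Strand} {a b : ℕ} :
    IsPath x (trivialSquare l a b r) y ↔
      l ++ [upStrand a, upStrand b] ++ r = x ∧ l ++ [upStrand a, upStrand b] ++ r = y := by
  simp [trivialSquare, IsPath, Slice.bot, Slice.top, Elementary.src, Elementary.tgt]

theorem trivialSquare_le {l l' r r' : List Strand} {a b a' b' : ℕ}
    (hl : List.Forall₂ Strand.Le l' l) (ha : a' ≤ a) (hb : b' ≤ b)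
    (hr : List.Forall₂ Strand.Le r' r) :
    List.Forall₂ SliceLe (trivialSquare l' a' b' r') (trivialSquare l a b r) := by
  have h1 : List.Forall₂ Strand.Le (l' ++ [upStrand a']) (l ++ [upStrand a]) :=
    List.rel_append hl (.cons ⟨rfl, ha⟩ .nil)
  have h2 : List.Forall₂ Strand.Le (upStrand b' :: r') (upStrand b :: r) := .cons ⟨rfl, hb⟩ hr
  exact .cons ⟨h1, ⟨le_rfl, hb⟩, hr⟩ (.cons ⟨hl, ⟨ha, le_rfl⟩, h2⟩
    (.cons ⟨hl, ⟨ha, le_rfl⟩, h2⟩ (.cons ⟨h1, ⟨le_rfl, hb⟩, hr⟩ .nil)))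

theorem exists_of_le_trivialSquare {l r x y : List Strand} {a b : ℕ} {v : MOYWord}
    (h : List.Forall₂ SliceLe v (trivialSquare l a b r)) (hp : IsPath x v y) :
    ∃ l' a' b' r', v = trivialSquare l' a' b' r' ∧ List.Forall₂ Strand.Le l' l ∧
      a' ≤ a ∧ b' ≤ b ∧ List.Forall₂ Strand.Le r' r := by
  simp only [trivialSquare, List.forall₂_cons_right_iff, List.forall₂_nil_right_iff] at h
  obtain ⟨⟨l₁, p₁, r₁⟩, _, ⟨hl₁, hq₁, hr₁⟩, ⟨⟨l₂, p₂, r₂⟩, _, ⟨hl₂, hq₂, hr₂⟩,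
    ⟨⟨l₃, p₃, r₃⟩, _, ⟨hl₃, hq₃, hr₃⟩, ⟨⟨l₄, p₄, r₄⟩, _, ⟨hl₄, hq₄, hr₄⟩, rfl, rfl⟩, rfl⟩,
    rfl⟩, rfl⟩ := h
  dsimp only at hl₁ hq₁ hr₁ hl₂ hq₂ hr₂ hl₃ hq₃ hr₃ hl₄ hq₄ hr₄
  cases p₁ <;> try exact hq₁.elim
  cases p₂ <;> try exact hq₂.elim
  cases p₃ <;> try exact hq₃.elim
  cases p₄ <;> try exact hq₄.elim
  rename_i x₁ b₁ a₂ x₂ a₃ x₃ x₄ b₄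
  obtain ⟨hx₁, hb₁⟩ := hq₁
  obtain ⟨ha₂, hx₂⟩ := hq₂
  obtain ⟨ha₃, hx₃⟩ := hq₃
  obtain ⟨hx₄, hb₄⟩ := hq₄
  simp only [Nat.le_zero] at hx₁ hx₂ hx₃ hx₄
  subst hx₁ hx₂ hx₃ hx₄
  obtain ⟨-, h12, h23, h34, -⟩ := hp
  simp only [Slice.bot, Slice.top, Elementary.src, Elementary.tgt] at h12 h23 h34
  have e₁ := hl₁.length_eq
  have e₂ := hl₂.length_eq
  have e₃ := hl₃.length_eq
  have e₄ := hl₄.length_eq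
  simp only [List.length_append, List.length_singleton] at e₁ e₄
  -- Consecutive lines agree, and comparing lengths splits off the strands left of the square.
  have h12' : l₂ ++ ([upStrand a₂, upStrand 0] ++ r₂) = l₁ ++ ([upStrand 0, upStrand b₁] ++ r₁) := by
    simpa using h12
  have h23' : l₃ ++ (upStrand (a₃ + 0) :: r₃) = l₂ ++ (upStrand (a₂ + 0) :: r₂) := by
    simpa using h23
  have h34' : l₄ ++ ([upStrand 0, upStrand b₄] ++ r₄) = l₃ ++ ([upStrand a₃, upStrand 0] ++ r₃) := by
    simpa using h34
  obtain ⟨rfl, hcons⟩ := List.append_inj h23' (by omega)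
  obtain ⟨ha, rfl⟩ := List.cons_eq_cons.1 hcons
  obtain rfl : a₃ = a₂ := by simpa using ha
  rw [show l₃ ++ ([upStrand a₃, upStrand 0] ++ r₃) = (l₃ ++ [upStrand a₃]) ++ (upStrand 0 :: r₃) by
    simp] at h12' h34'
  obtain ⟨rfl, h12r⟩ := List.append_inj h12' (by simp; omega)
  obtain ⟨rfl, h34r⟩ := List.append_inj h34' (by simp; omega)
  obtain ⟨-, rfl⟩ := List.cons_eq_cons.1 h12r
  obtain ⟨-, h34r⟩ := List.cons_eq_cons.1 h34r
  obtain ⟨hb, rfl⟩ := List.cons_eq_cons.1 h34r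
  obtain rfl : b₄ = b₁ := by simpa using hb
  exact ⟨_, _, _, _, rfl, hl₂, ha₂, hb₁, hr₁⟩

/-- The closed graph `v'` is obtained from the closed graph `v` by erasing the trivial rungs of a
square that starts above the `p` lowest slices and has `k` strands on its left. Sub-MOY graphs of
one graph are all erased at the same place, whence the parameters `p` and `k`. -/
def IsErasure (p k : ℕ) (v v' : MOYWord) : Prop :=
  ∃ A l a b r B, v = A ++ trivialSquare l a b r ++ B ∧ v' = A ++ B ∧ A.length = p ∧ l.length = k ∧
    IsPath [] A (l ++ [upStrand a, upStrand b] ++ r) ∧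
    IsPath (l ++ [upStrand a, upStrand b] ++ r) B []

/-- The word `v` without the slices number `p`, …, `p + 3`. -/
def eraseSquare (p : ℕ) (v : MOYWord) : MOYWord := v.take p ++ v.drop (p + 4)

theorem IsErasure.eraseSquare_eq {p k : ℕ} {v v' : MOYWord} (h : IsErasure p k v v') :
    eraseSquare p v = v' := by
  obtain ⟨A, l, a, b, r, B, rfl, rfl, rfl, rfl, -, -⟩ := h
  have h4 : A.length + 4 = (A ++ trivialSquare l a b r).length := by simp [trivialSquare]
  rw [eraseSquare, h4, List.drop_left, List.append_assoc, List.take_left]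

theorem IsErasure.left_unique {p k : ℕ} {v w v' : MOYWord} (hv : IsErasure p k v v')
    (hw : IsErasure p k w v') : v = w := by
  obtain ⟨A, l, a, b, r, B, rfl, rfl, rfl, rfl, hA, -⟩ := hv
  obtain ⟨A₂, l₂, a₂, b₂, r₂, B₂, rfl, he, hp, hk, hA₂, -⟩ := hw
  obtain ⟨rfl, rfl⟩ := List.append_inj he hp.symm
  obtain ⟨rfl, rfl, rfl, rfl⟩ := middle_inj hk.symm (hA.right_unique hA₂)
  rfl

/-- The sub-MOY graphs of a graph that contains a square with trivial rungs contain such a square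
at the same place. -/
theorem IsErasure.exists_right {p k : ℕ} {v w w' : MOYWord} (hw : IsErasure p k w w')
    (h : IsSubMOY v w) : ∃ v', IsErasure p k v v' ∧ IsSubMOY v' w' := by
  obtain ⟨A, l, a, b, r, B, rfl, rfl, rfl, rfl, -, -⟩ := hw
  obtain ⟨hc, hle⟩ := h
  obtain ⟨_, B', rfl, h1, hB⟩ := exists_of_forall₂_append hle
  obtain ⟨A', S, rfl, hA, hS⟩ := exists_of_forall₂_append h1
  obtain ⟨y, hy, hpB⟩ := isPath_append.1 hc
  obtain ⟨x, hpA, hpS⟩ := isPath_append.1 hy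
  obtain ⟨l', a', b', r', rfl, hl, -, -, -⟩ := exists_of_le_trivialSquare hS hpS
  obtain ⟨rfl, rfl⟩ := isPath_trivialSquare.1 hpS
  exact ⟨A' ++ B', ⟨A', l', a', b', r', B', rfl, rfl, hA.length_eq, hl.length_eq, hpA, hpB⟩,
    isPath_append.2 ⟨_, hpA, hpB⟩, List.rel_append hA hB⟩

/-- A square with trivial rungs can be inserted into every sub-MOY graph, with labels given by the
strands at that place. -/
theorem IsErasure.exists_left {p k : ℕ} {v' w w' : MOYWord} (hw : IsErasure p k w w')
    (h : IsSubMOY v' w') : ∃ v, IsErasure p k v v' ∧ IsSubMOY v w := by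
  obtain ⟨A, l, a, b, r, B, rfl, rfl, rfl, rfl, hA, -⟩ := hw
  obtain ⟨hc, hle⟩ := h
  obtain ⟨A', B', rfl, hA', hB'⟩ := exists_of_forall₂_append hle
  obtain ⟨x, hpA, hpB⟩ := isPath_append.1 hc
  obtain ⟨l', a', b', r', rfl, hl, ha, hb, hr⟩ :=
    forall₂_le_middle (IsPath.forall₂_le .nil hA' hpA hA)
  exact ⟨_, ⟨A', l', a', b', r', B', rfl, rfl, hA'.length_eq, hl.length_eq, hpA, hpB⟩,
    isPath_append.2 ⟨_, isPath_append.2 ⟨_, hpA, isPath_trivialSquare.2 ⟨rfl, rfl⟩⟩, hpB⟩,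
    List.rel_append (List.rel_append hA' (trivialSquare_le hl ha hb hr)) hB'⟩

/-! ### Weights -/

theorem qbinom_eq_zero {n k : ℕ} (h : n < k) : qbinom n k = 0 := by
  induction n generalizing k with
  | zero =>
    obtain _ | k := k
    · omega
    · rfl
  | succ n ih =>
    obtain _ | k := k
    · omega
    · rw [qbinom, ih (by omega), ih (by omega), mul_zero, mul_zero, add_zero]

theorem qbinom_self (n : ℕ) : qbinom n n = 1 := by
  induction n with
  | zero => rfl
  | succ n ih => rw [qbinom, qbinom_eq_zero (by omega), ih]; simp

theorem IsErasure.rotational_eq {p k : ℕ} {v v' : MOYWord} (h : IsErasure p k v v') :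
    rotational v = rotational v' := by
  obtain ⟨A, l, a, b, r, B, rfl, rfl, -⟩ := h
  simp [rotational, cabling, trivialSquare, cableSlice]

theorem IsErasure.binomialWeight_eq {p k : ℕ} {v v' : MOYWord} (h : IsErasure p k v v') :
    binomialWeight v = binomialWeight v' := by
  obtain ⟨A, l, a, b, r, B, rfl, rfl, -⟩ := h
  simp [binomialWeight, trivialSquare, qbinom_self, qbinom]

theorem IsErasure.u_eq {p k : ℕ} {v v' w w' : MOYWord} (hv : IsErasure p k v v')
    (hw : IsErasure p k w w') : u v w = u v' w' := by
  obtain ⟨A, l, a, b, r, B, rfl, rfl, rfl, -⟩ := hv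
  obtain ⟨A₂, l₂, a₂, b₂, r₂, B₂, rfl, rfl, hp, -⟩ := hw
  rw [u, u, List.zipWith_append (by simp [trivialSquare, hp]), List.zipWith_append hp.symm,
    List.zipWith_append hp.symm]
  simp [trivialSquare, uSlice]

theorem IsErasure.evalColoring_eq {N M p k : ℕ} {c c' : (Fin N → MOYWord) × (Fin M → MOYWord)}
    (hE : ∀ i, IsErasure p k (c.1 i) (c'.1 i)) (hS : ∀ j, IsErasure p k (c.2 j) (c'.2 j)) :
    evalColoring N M c = evalColoring N M c' := by
  simp only [evalColoring, parity, sWeight, rhoWeight, multiplicity, (hE _).rotational_eq,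
    (hS _).rotational_eq, (hS _).binomialWeight_eq, (hE _).u_eq (hE _), (hE _).u_eq (hS _),
    (hS _).u_eq (hS _)]

/-! ### Labels -/

theorem label_append_left {v w : MOYWord} {t : ℕ} (ht : t < v.length) (i : ℕ) :
    label (v ++ w) t i = label v t i := by
  simp [label, List.getD_eq_getElem?_getD, List.getElem?_append, ht]

theorem label_append_right (v w : MOYWord) (t i : ℕ) :
    label (v ++ w) (v.length + t) i = label w t i := by
  simp [label, List.getD_eq_getElem?_getD, List.getElem?_append]

theorem label_append_cons (v w : MOYWord) (s : Slice MOYPiece) (i : ℕ) :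
    label (v ++ s :: w) v.length i = (s.bot.map Strand.label).getD i 0 :=
  label_append_right v (s :: w) 0 i

theorem getD_append_zero_cons (x y : List ℕ) (i : ℕ) :
    (x ++ 0 :: y).getD i 0 = if i < x.length then (x ++ y).getD i 0
      else if i = x.length then 0 else (x ++ y).getD (i - 1) 0 := by
  simp only [List.getD_eq_getElem?_getD, List.getElem?_append]
  split_ifs with h1 h2 h3
  · rfl
  · simp [h2]
  · omega
  · obtain ⟨j, rfl⟩ : ∃ j, i = x.length + (j + 1) := ⟨i - x.length - 1, by omega⟩
    simp

/-- Each label of `v` is `0` by the shape of the graph, or is a label of `v'` at a place which only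
depends on `p` and `k`. -/
theorem IsErasure.label_left (p k t i : ℕ) :
    (∀ v v', IsErasure p k v v' → label v t i = 0) ∨
      ∃ t' i', ∀ v v', IsErasure p k v v' → label v t i = label v' t' i' := by
  -- The lines below the splits of the square coincide with the line `p` of `v'`.
  have even : ∀ {v v' : MOYWord} (j : ℕ), j = 0 ∨ j = 2 → IsErasure p k v v' →
      label v (p + j) i = label v' p i := by
    rintro _ _ j hj ⟨A, l, a, b, r, B, rfl, rfl, rfl, rfl, -, hB⟩
    obtain ⟨s, B, rfl, hs⟩ := hB.exists_cons (by simp)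
    rw [List.append_assoc, label_append_right, label_append_cons, hs]
    obtain rfl | rfl := hj <;> simp [label, trivialSquare, Slice.bot, Elementary.src]
  -- The lines below the merges have one more strand, labeled `0`, in position `k + 1`.
  have odd : ∀ {v v' : MOYWord} (j : ℕ), j = 1 ∨ j = 3 → IsErasure p k v v' →
      label v (p + j) i = if i < k + 1 then label v' p i
        else if i = k + 1 then 0 else label v' p (i - 1) := by
    rintro _ _ j hj ⟨A, l, a, b, r, B, rfl, rfl, rfl, rfl, -, hB⟩
    obtain ⟨s, B, rfl, hs⟩ := hB.exists_cons (by simp)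
    have key := getD_append_zero_cons ((l ++ [upStrand a]).map Strand.label)
      ((upStrand b :: r).map Strand.label) i
    rw [List.append_assoc, label_append_right, label_append_cons, label_append_cons, hs]
    obtain rfl | rfl := hj <;>
      simpa [label, trivialSquare, Slice.bot, Elementary.src] using key
  obtain ht | ht := lt_or_ge t p
  · refine .inr ⟨t, i, ?_⟩
    rintro _ _ ⟨A, l, a, b, r, B, rfl, rfl, rfl, -⟩
    rw [List.append_assoc, label_append_left ht, label_append_left ht]
  obtain ⟨j, rfl⟩ := Nat.exists_eq_add_of_le ht
  obtain hj | hj := lt_or_ge j 4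
  · by_cases he : j = 0 ∨ j = 2
    · exact .inr ⟨p, i, fun _ _ h => even j he h⟩
    · have ho : j = 1 ∨ j = 3 := by omega
      obtain hi | rfl | hi := lt_trichotomy i (k + 1)
      · exact .inr ⟨p, i, fun _ _ h => by rw [odd j ho h, if_pos hi]⟩
      · exact .inl fun _ _ h => by rw [odd j ho h, if_neg (by omega), if_pos rfl]
      · exact .inr ⟨p, i - 1, fun _ _ h => by
          rw [odd j ho h, if_neg (by omega), if_neg (by omega)]⟩
  · obtain ⟨t, rfl⟩ := Nat.exists_eq_add_of_le hj
    refine .inr ⟨p + t, i, ?_⟩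
    rintro _ _ ⟨A, l, a, b, r, B, rfl, rfl, rfl, -⟩
    rw [label_append_right, ← label_append_right (A ++ trivialSquare l a b r) B t i]
    congr 1
    simp [trivialSquare, add_assoc]

/-- Each label of `v'` is a label of `v` at a place which only depends on `p`. -/
theorem IsErasure.label_right (p k t i : ℕ) :
    ∃ t', ∀ v v', IsErasure p k v v' → label v' t i = label v t' i := by
  obtain ht | ht := lt_or_ge t p
  · refine ⟨t, ?_⟩
    rintro _ _ ⟨A, l, a, b, r, B, rfl, rfl, rfl, -⟩
    rw [List.append_assoc, label_append_left ht, label_append_left ht]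
  · obtain ⟨t, rfl⟩ := Nat.exists_eq_add_of_le ht
    refine ⟨p + 4 + t, ?_⟩
    rintro _ _ ⟨A, l, a, b, r, B, rfl, rfl, rfl, -⟩
    rw [label_append_right, ← label_append_right (A ++ trivialSquare l a b r) B t i]
    congr 1
    simp [trivialSquare, add_assoc]

/-! ### Erasing trivial rungs -/

theorem IsErasure.isColoring_right {N M p k : ℕ} {w w' : MOYWord}
    {c c' : (Fin N → MOYWord) × (Fin M → MOYWord)} (hw : IsErasure p k w w')
    (hE : ∀ i, IsErasure p k (c.1 i) (c'.1 i) ∧ IsSubMOY (c'.1 i) w')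
    (hS : ∀ j, IsErasure p k (c.2 j) (c'.2 j) ∧ IsSubMOY (c'.2 j) w')
    (h : IsColoring N M w c) : IsColoring N M w' c' where
  subE i := (hE i).2
  subS j := (hS j).2
  cyclicE i t s := by
    obtain ⟨t', ht⟩ := IsErasure.label_right p k t s
    rw [ht _ _ (hE i).1]
    exact h.cyclicE i t' s
  sum_eq t s := by
    obtain ⟨t', ht⟩ := IsErasure.label_right p k t s
    simp only [ht _ _ (hE _).1, ht _ _ (hS _).1, ht _ _ hw, h.sum_eq]

theorem IsErasure.isColoring_left {N M p k : ℕ} {w w' : MOYWord}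
    {c c' : (Fin N → MOYWord) × (Fin M → MOYWord)} (hw : IsErasure p k w w')
    (hE : ∀ i, IsErasure p k (c.1 i) (c'.1 i) ∧ IsSubMOY (c.1 i) w)
    (hS : ∀ j, IsErasure p k (c.2 j) (c'.2 j) ∧ IsSubMOY (c.2 j) w)
    (h : IsColoring N M w' c') : IsColoring N M w c where
  subE i := (hE i).2
  subS j := (hS j).2
  cyclicE i t s := by
    obtain ht | ⟨t', s', ht⟩ := IsErasure.label_left p k t s <;> rw [ht _ _ (hE i).1]
    · exact zero_le_one
    · exact h.cyclicE i t' s'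
  sum_eq t s := by
    obtain ht | ⟨t', s', ht⟩ := IsErasure.label_left p k t s
    · simp [ht _ _ (hE _).1, ht _ _ (hS _).1, ht _ _ hw]
    · simp only [ht _ _ (hE _).1, ht _ _ (hS _).1, ht _ _ hw, h.sum_eq]

theorem mem_colorings {N M : ℕ} {w : MOYWord} {c : (Fin N → MOYWord) × (Fin M → MOYWord)} :
    c ∈ colorings N M w ↔ IsColoring N M w c := by
  simp [colorings]

/-- Erasing edges with label `0` does not change the evaluation. -/
theorem IsErasure.evalMOY_eq {N M p k : ℕ} {w w' : MOYWord} (hw : IsErasure p k w w') :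
    evalMOY N M w = evalMOY N M w' := by
  have erase : ∀ {v}, IsSubMOY v w →
      IsErasure p k v (eraseSquare p v) ∧ IsSubMOY (eraseSquare p v) w' := by
    intro v hv
    obtain ⟨v', h1, h2⟩ := hw.exists_right hv
    rw [h1.eraseSquare_eq]
    exact ⟨h1, h2⟩
  refine Finset.sum_nbij
    (fun c => (fun i => eraseSquare p (c.1 i), fun j => eraseSquare p (c.2 j))) ?_ ?_ ?_ ?_
  · intro c hc
    rw [mem_colorings] at hc ⊢
    exact hw.isColoring_right (fun i => erase (hc.subE i)) (fun j => erase (hc.subS j)) hc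
  · intro c hc d hd hcd
    rw [Finset.mem_coe, mem_colorings] at hc hd
    obtain ⟨h1, h2⟩ := Prod.mk.inj hcd
    refine Prod.ext (funext fun i => ?_) (funext fun j => ?_)
    · refine (erase (hc.subE i)).1.left_unique ?_
      rw [congrFun h1 i]
      exact (erase (hd.subE i)).1
    · refine (erase (hc.subS j)).1.left_unique ?_
      rw [congrFun h2 j]
      exact (erase (hd.subS j)).1
  · intro c hc
    rw [Finset.mem_coe, mem_colorings] at hc
    choose e he using fun i => hw.exists_left (hc.subE i)
    choose s hs using fun j => hw.exists_left (hc.subS j)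
    refine ⟨(e, s), mem_colorings.2 (hw.isColoring_left (c := (e, s)) he hs hc), ?_⟩
    exact Prod.ext (funext fun i => (he i).1.eraseSquare_eq)
      (funext fun j => (hs j).1.eraseSquare_eq)
  · intro c hc
    rw [mem_colorings] at hc
    exact IsErasure.evalColoring_eq (fun i => (erase (hc.subE i)).1)
      (fun j => (erase (hc.subS j)).1)

/-! ### The skein relation -/

theorem bracketAux_trivialSquare (N M : ℕ) {A W : MOYWord} {l r y : List Strand} {a b : ℕ}
    {D : List (Slice LinkPiece)} (hA : IsPath [] A (l ++ [upStrand a, upStrand b] ++ r))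
    (hW : IsPath (l ++ [upStrand a, upStrand b] ++ r) W y) (hD : IsPath y D []) :
    bracketAux N M (A ++ trivialSquare l a b r ++ W) D = bracketAux N M (A ++ W) D := by
  induction D generalizing W y with
  | nil =>
    cases hD
    exact IsErasure.evalMOY_eq ⟨A, l, a, b, r, W, rfl, rfl, rfl, rfl, hA, hW⟩
  | cons s D ih =>
    obtain ⟨x, p, z⟩ := s
    obtain ⟨rfl, hD⟩ := hD
    cases p with
    | cup d m =>
      simp only [bracketAux]
      rw [List.append_assoc _ W, List.append_assoc A W]
      exact ih (isPath_append.2 ⟨_, hW, rfl, rfl⟩) hD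
    | cap d m =>
      simp only [bracketAux]
      rw [List.append_assoc _ W, List.append_assoc A W]
      exact ih (isPath_append.2 ⟨_, hW, rfl, rfl⟩) hD
    | crossing e n m =>
      simp only [bracketAux]
      refine Finset.sum_congr rfl fun k hk => ?_
      rw [List.append_assoc _ W, List.append_assoc A W]
      exact congrArg _ (ih (isPath_append.2 ⟨_, hW, isPath_square x n m k z hk⟩) hD)

/-- The skein relation for the bracket, before the framing factors: the two resolutions differ by a
multiple of the graph with trivial rungs. -/
theorem bracketAux_skein (N M : ℕ) {A B : List (Slice LinkPiece)} {w : MOYWord}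
    {l r x : List Strand} (hw : IsPath [] w x)
    (hA : IsPath x A (l ++ [upStrand 1, upStrand 1] ++ r))
    (hB : IsPath (l ++ [upStrand 1, upStrand 1] ++ r) B []) :
    bracketAux N M w (A ++ ⟨l, .crossing .pos 1 1, r⟩ :: B) -
        bracketAux N M w (A ++ ⟨l, .crossing .neg 1 1, r⟩ :: B) =
      (qpow 1 - qpow (-1)) * bracketAux N M w (A ++ B) := by
  induction A generalizing w x with
  | nil =>
    cases hA
    have h0 : bracketAux N M (w ++ square l 1 1 0 r) B = bracketAux N M w B := by
      change bracketAux N M (w ++ trivialSquare l 1 1 r) B = bracketAux N M w B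
      simpa using bracketAux_trivialSquare N M (W := []) hw rfl hB
    have hI : Finset.Icc (1 - 1) 1 = ({0, 1} : Finset ℕ) := rfl
    simp only [List.nil_append, bracketAux, hI, CrossingSign.toInt]
    rw [Finset.sum_pair zero_ne_one, Finset.sum_pair zero_ne_one, h0]
    simp [qpow]
    ring
  | cons s A ih =>
    obtain ⟨y, p, z⟩ := s
    obtain ⟨rfl, hA⟩ := hA
    cases p with
    | cup d m => exact ih (isPath_append.2 ⟨_, hw, rfl, rfl⟩) hA
    | cap d m => exact ih (isPath_append.2 ⟨_, hw, rfl, rfl⟩) hA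
    | crossing e n m =>
      simp only [List.cons_append, bracketAux]
      rw [← Finset.sum_sub_distrib, Finset.mul_sum]
      refine Finset.sum_congr rfl fun k hk => ?_
      rw [← mul_sub, ih (isPath_append.2 ⟨_, hw, isPath_square y n m k z hk⟩) hA]
      ring

end MOY

open MOY in
theorem proposition3 (N M : ℕ) (Dp Dn D0 : MOY.LinkDiagram) (h : MOY.SkeinTriple Dp Dn D0) :
    MOY.qpow ((M : ℤ) - N) * MOY.P N M Dp - MOY.qpow ((N : ℤ) - M) * MOY.P N M Dn =
      (MOY.qpow (-1) - MOY.qpow 1) * MOY.P N M D0 := by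
  obtain ⟨A, B, l, r, hp, hn, h0⟩ := h
  have hc := Dp.closed
  rw [hp, List.append_assoc, IsClosedWord, isPath_append] at hc
  obtain ⟨x, hA, rfl, hB⟩ := hc
  have key : bracketAux N M [] (A ++ ⟨l, .crossing .pos 1 1, r⟩ :: B) -
      bracketAux N M [] (A ++ ⟨l, .crossing .neg 1 1, r⟩ :: B) =
        (qpow 1 - qpow (-1)) * bracketAux N M [] (A ++ B) := bracketAux_skein N M rfl hA hB
  have hadd (i j : ℤ) : qpow (i + j) = qpow i * qpow j := LaurentPolynomial.T_add i j
  have hk : ((Dp.slices.map (kSlice N M)).sum =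
        (D0.slices.map (kSlice N M)).sum + ((N : ℤ) - M)) ∧
      ((Dn.slices.map (kSlice N M)).sum =
        (D0.slices.map (kSlice N M)).sum - ((N : ℤ) - M)) := by
    constructor <;> simp [hp, hn, h0, kSlice, CrossingSign.toInt] <;> ring
  have he : ((Dp.slices.map eSlice).sum = (D0.slices.map eSlice).sum + 1) ∧
      ((Dn.slices.map eSlice).sum = (D0.slices.map eSlice).sum + 1) := by
    constructor <;> simp [hp, hn, h0, eSlice] <;> ring
  have hq₁ : qpow ((M : ℤ) - N) * qpow ((N : ℤ) - M) = 1 := by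
    rw [← hadd]; simp
  have hq₂ : qpow ((N : ℤ) - M) * qpow (-((N : ℤ) - M)) = 1 := by
    rw [← hadd]; simp
  unfold P bracket
  rw [hk.1, hk.2, he.1, he.2, hp, hn, h0, List.append_assoc, List.append_assoc]
  simp only [List.singleton_append]
  rw [sub_eq_add_neg _ ((N : ℤ) - M)]
  rw [hadd, hadd, pow_succ]
  set c : LaurentPolynomial ℤ :=
    (-1) ^ ((A ++ B).map eSlice).sum * qpow ((A ++ B).map (kSlice N M)).sum
  linear_combination (-c * bracketAux N M [] (A ++ ⟨l, .crossing .pos 1 1, r⟩ :: B)) * hq₁ +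
    c * bracketAux N M [] (A ++ ⟨l, .crossing .neg 1 1, r⟩ :: B) * hq₂ - c * key
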